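/- Let $X^\star\in\mathbb R^{n_1\times n_2}$ have rank $r\ge 1$, let $X^\star=U^\star\Sigma^\star V^{\star\top}$ be a rank-$r$ singular value decomposition ($U^{\star\top}U^\star=V^{\star\top}V^\star=I_r$, $\Sigma^\star=\mathrm{diag}(\sigma_1^\star\ge\dots\ge\sigma_r^\star>0)$), put $\kappa=\sigma_1^\star/\sigma_r^\star$, $n=\max(n_1,n_2)$, $n_1\wedge n_2=\min(n_1,n_2)$, and suppose that $X^\star$ is $\mu$-incoherent: $\|U^\star\|_{2,\infty}\le\sqrt{\mu r/n_1}$ and $\|V^\star\|_{2,\infty}\le\sqrt{\mu r/n_2}$, where $\|\cdot\|_{2,\infty}$ is the largest Euclidean norm of a row. Let $$Z^\star=\begin{bmatrix}U^\star\\ V^\star\end{bmatrix}\Sigma^{\star 1/2},\qquad \mathcal S=\{Z^\star R: R\in\mathbb R^{r\times r},\ RR^\top=R^\top R=I\}.$$ Let each entry of $X^\star$ be observed independently with probability $p\in(0,1]$, let $\Omega$ be the set of observed positions, and let $\mathcal P_\Omega$ be the operator that keeps the entries in $\Omega$ and sets the others to zero. For a rank-$r$ truncated singular value decomposition $U^0\Sigma^0V^{0\top}$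 of $p^{-1}\mathcal P_\Omega(X^\star)$ (the top $r$ singular values, with corresponding orthonormal singular vectors), let $$Z^0=\begin{bmatrix}U^0\\ V^0\end{bmatrix}(\Sigma^0)^{1/2},\qquad \mathcal C=\Big\{Z\in\mathbb R^{(n_1+n_2)\times r}:\|Z\|_{2,\infty}\le\sqrt{\tfrac{2\mu r}{n_1\wedge n_2}}\,\|Z^0\|\Big\},$$ where $\|\cdot\|$ is the operator norm. There exist universal constants $c,c_1,c_2>0$ such that, if $$p\ \ge\ \frac{c\,\mu r^2\kappa^2\log n}{n_1\wedge n_2},$$ then with probability at least $1-c_1n^{-c_2}$, for every choice of the truncated singular value decomposition defining $Z^0$, $$\|Z^\star\|_{2,\infty}\le\sqrt{\frac{2\mu r}{n_1\wedge n_2}}\,\|Z^0\|,\qquad\text{and hence}\qquad \mathcal S\subseteq\mathcal C .$$ -/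

import Mathlib

open scoped Matrix

namespace MatrixCompletion

open scoped Matrix.Norms.L2Operator in
/-- The operator (spectral) norm of a real matrix. -/
noncomputable def opNorm {ι κ : Type*} [Fintype ι] [Fintype κ] [DecidableEq κ]
    (A : Matrix ι κ ℝ) : ℝ := ‖A‖

/-- The norm `‖Z‖_{2,∞}`: the largest Euclidean norm of a row of `Z`. -/
noncomputable def twoInftyNorm {ι κ : Type*} [Fintype ι] [Fintype κ]
    (Z : Matrix ι κ ℝ) : ℝ :=
  ⨆ i, ‖WithLp.toLp 2 (Z i)‖

/-- The singular values of `A`, in decreasing order with multiplicity, indexed from `0`. -/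
noncomputable def singularValue {n₁ n₂ : ℕ} (A : Matrix (Fin n₁) (Fin n₂) ℝ) (i : ℕ) : ℝ :=
  A.toEuclideanLin.singularValues i

/-- The ratio of the largest to the smallest nonzero singular value (of a nonzero matrix). -/
noncomputable def condNumber {n₁ n₂ : ℕ} (A : Matrix (Fin n₁) (Fin n₂) ℝ) : ℝ :=
  singularValue A 0 / singularValue A (A.rank - 1)

/-- `U diag(σ) Vᵀ` is a rank-`r` (truncated) singular value decomposition of `A`: `σ` lists the
`r` largest singular values of `A` in decreasing order, and the columns of `U` and `V` are
corresponding orthonormal left and right singular vectors. When `A` has rank `r` this is the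
compact singular value decomposition `A = U diag(σ) Vᵀ`. -/
structure IsRankSVD {n₁ n₂ r : ℕ} (A : Matrix (Fin n₁) (Fin n₂) ℝ)
    (U : Matrix (Fin n₁) (Fin r) ℝ) (σ : Fin r → ℝ) (V : Matrix (Fin n₂) (Fin r) ℝ) : Prop where
  orthonormal_left : Uᵀ * U = 1
  orthonormal_right : Vᵀ * V = 1
  mul_right : A * V = U * Matrix.diagonal σ
  transpose_mul_left : Aᵀ * U = V * Matrix.diagonal σ
  eq_singularValue : ∀ i : Fin r, σ i = singularValue A i

/-- `μ`-incoherence of the left and right singular vectors. -/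
def IsIncoherent {n₁ n₂ r : ℕ} (μ : ℝ)
    (U : Matrix (Fin n₁) (Fin r) ℝ) (V : Matrix (Fin n₂) (Fin r) ℝ) : Prop :=
  twoInftyNorm U ≤ √(μ * r / n₁) ∧ twoInftyNorm V ≤ √(μ * r / n₂)

/-- The factor `[U ; V] diag(σ)^{1/2}`. -/
noncomputable def liftedFactor {n₁ n₂ r : ℕ}
    (U : Matrix (Fin n₁) (Fin r) ℝ) (σ : Fin r → ℝ) (V : Matrix (Fin n₂) (Fin r) ℝ) :
    Matrix (Fin n₁ ⊕ Fin n₂) (Fin r) ℝ :=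
  Matrix.fromRows U V * Matrix.diagonal (fun i => √(σ i))

/-- The set of all `Z R` with `R` orthogonal. -/
def solutionSet {n₁ n₂ r : ℕ} (Z : Matrix (Fin n₁ ⊕ Fin n₂) (Fin r) ℝ) :
    Set (Matrix (Fin n₁ ⊕ Fin n₂) (Fin r) ℝ) :=
  {W | ∃ R : Matrix (Fin r) (Fin r) ℝ, R * Rᵀ = 1 ∧ Rᵀ * R = 1 ∧ W = Z * R}

/-- The feasible set of incoherent factors determined by `μ` and the initial factor `Z₀`. -/
def feasibleSet {n₁ n₂ r : ℕ} (μ : ℝ) (Z₀ : Matrix (Fin n₁ ⊕ Fin n₂) (Fin r) ℝ) :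
    Set (Matrix (Fin n₁ ⊕ Fin n₂) (Fin r) ℝ) :=
  {Z | twoInftyNorm Z ≤ √(2 * μ * r / (min n₁ n₂ : ℕ)) * opNorm Z₀}

open Classical in
/-- The sampling operator: keep the entries in `Ω`, put zero elsewhere. -/
noncomputable def sample {n₁ n₂ : ℕ} (Ω : Set (Fin n₁ × Fin n₂))
    (X : Matrix (Fin n₁) (Fin n₂) ℝ) : Matrix (Fin n₁) (Fin n₂) ℝ :=
  Matrix.of fun i j => if (i, j) ∈ Ω then X i j else 0

end MatrixCompletion

/-! Only a lower bound on the top singular value of the rescaled sample `A` is needed, so scalar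
concentration suffices. Put b = μr / min(n₁, n₂). Incoherence gives ‖Z⋆‖_{2,∞} ≤ √(b σ₁), while the
first column of Z⁰ has norm √(2 σ₁(A)), a lower bound for ‖Z⁰‖; σ₁(A) ≥ σ₁/2 is therefore more than
enough. Testing `A` against the true top singular vectors, σ₁(A) ≥ u₁ᵀ A v₁, which is a weighted
Bernoulli sum of mean σ₁. Since |Xᵢⱼ| ≤ σ₁ b and u₁, v₁ are unit vectors, its squared weights total
at most (σ₁ b)², and Hoeffding (`setBernoulli_weighted_sum_lower_tail`) bounds the failure
probability by exp(-2 log² n) once p ≥ 2b log n. Right multiplication by an orthogonal matrix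
preserves row norms, which gives the inclusion. -/

namespace MatrixCompletion

/-! ### Concentration for Bernoulli subsets -/

open MeasureTheory ProbabilityTheory unitInterval in
open Classical in
/-- Lower-tail Hoeffding inequality for a weighted sum over a Bernoulli random subset. -/
theorem setBernoulli_weighted_sum_lower_tail {ι : Type*} [Fintype ι] (p : I) (a : ι → ℝ)
    {ε : ℝ} (hε : 0 ≤ ε) :
    (setBernoulli (Set.univ : Set ι) p).real
        {Ω | ε ≤ p * ∑ i, a i - ∑ i, if i ∈ Ω then a i else 0} ≤
      Real.exp (-ε ^ 2 / (2 * ∑ i, (|a i| / 2) ^ 2)) := by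
  set ν : Measure Prop := toNNReal p • Measure.dirac True + toNNReal (σ p) • Measure.dirac False
    with hν
  have hνp : IsProbabilityMeasure ν := by
    constructor
    simp only [hν, Measure.add_apply, Measure.smul_apply, measure_univ, ENNReal.smul_def,
      smul_eq_mul, mul_one, ← ENNReal.coe_add, toNNReal_add_toNNReal_symm,
      ENNReal.coe_one]
  -- Negating the weights turns the lower tail into an upper tail of independent centred variables
  -- under a product of copies of `ν`.
  have key : (setBernoulli (Set.univ : Set ι) p).real
        {Ω | ε ≤ p * ∑ i, a i - ∑ i, if i ∈ Ω then a i else 0} =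
      (Measure.infinitePi fun _ : ι => ν).real
        {ω | ε ≤ ∑ i, ((fun q : Prop => if q then -a i else 0) (ω i) - -(p * a i))} := by
    rw [measureReal_def, setBernoulli_apply', measureReal_def]
    congr! 4
    ext ω
    simp only [Set.mem_preimage, Set.mem_ofPred_eq]
    have : (∑ i, ((if ω i then -a i else 0) - -(p * a i))) =
        p * ∑ i, a i - ∑ i, if ω i then a i else 0 := by
      rw [Finset.mul_sum, ← Finset.sum_sub_distrib]
      refine Finset.sum_congr rfl fun i _ => ?_
      split_ifs <;> ring
    rw [this]
  rw [key]
  have hsub : ∀ i, HasSubgaussianMGF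
      (fun q : Prop => (if q then -a i else 0) - -(p * a i)) ((‖a i‖₊ / 2) ^ 2) ν := by
    intro i
    have hint : ∫ q : Prop, (if q then -a i else 0) ∂ν = -(p * a i) := by
      rw [hν, integral_add_measure (Integrable.of_finite) (Integrable.of_finite)]
      simp [NNReal.smul_def]
    have hb : ∀ q : Prop, (if q then -a i else 0) ∈
        Set.Icc (min (-a i) 0) (max (-a i) 0) := by
      intro q; split_ifs <;> simp
    have := hasSubgaussianMGF_of_mem_Icc (μ := ν)
      (X := fun q : Prop => if q then -a i else 0)
      (measurable_of_finite _).aemeasurable (ae_of_all _ hb)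
    rw [hint] at this
    convert this using 3
    rw [← NNReal.coe_inj, coe_nnnorm, coe_nnnorm, max_sub_min_eq_abs]
    simp
  have hind : iIndepFun (fun i (ω : ι → Prop) =>
      (fun q : Prop => (if q then -a i else 0) - -(p * a i)) (ω i))
      (Measure.infinitePi fun _ : ι => ν) :=
    iIndepFun_infinitePi (X := fun i (q : Prop) => (if q then -a i else 0) - -(p * a i))
      fun i => measurable_of_finite _
  have := HasSubgaussianMGF.measure_sum_ge_le_of_iIndepFun hind
    (c := fun i => (‖a i‖₊ / 2) ^ 2) (s := Finset.univ) (fun i _ => by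
      have hm : (Measure.infinitePi fun _ : ι => ν).map (fun ω => ω i) = ν :=
        Measure.infinitePi_map_eval _ i
      have h := hsub i
      rw [← hm] at h
      have hmeas : Measurable fun ω : ι → Prop => ω i := measurable_pi_apply i
      exact h.of_map hmeas.aemeasurable) hε
  simpa using this

/-! ### Singular values and row norms -/

theorem singularValue_nonneg {n₁ n₂ : ℕ} (A : Matrix (Fin n₁) (Fin n₂) ℝ) (i : ℕ) :
    0 ≤ singularValue A i := LinearMap.singularValues_nonneg _ i

theorem singularValue_pos_iff {n₁ n₂ : ℕ} {A : Matrix (Fin n₁) (Fin n₂) ℝ} {i : ℕ} :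
    0 < singularValue A i ↔ i < A.rank := by
  rw [singularValue, LinearMap.singularValues_pos_iff_lt_finrank_range,
    Matrix.rank_eq_finrank_range_toLin A (PiLp.basisFun 2 ℝ _) (PiLp.basisFun 2 ℝ _)]
  rfl

/-- The largest singular value bounds the norm of the image of a vector. -/
theorem norm_le_singularValues_zero {E F : Type*} [NormedAddCommGroup E] [InnerProductSpace ℝ E]
    [FiniteDimensional ℝ E] [NormedAddCommGroup F] [InnerProductSpace ℝ F] [FiniteDimensional ℝ F]
    (T : E →ₗ[ℝ] F) (x : E) : ‖T x‖ ≤ T.singularValues 0 * ‖x‖ := by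
  refine abs_le_of_sq_le_sq' ?_ (mul_nonneg (T.singularValues_nonneg 0) (norm_nonneg x)) |>.2
  set hT := T.isSymmetric_adjoint_comp_self
  have h1 : ‖T x‖ ^ 2 = ∑ i, hT.eigenvalues rfl i * (hT.eigenvectorBasis rfl).repr x i ^ 2 := by
    rw [← real_inner_self_eq_norm_sq, ← LinearMap.adjoint_inner_left, ← LinearMap.comp_apply,
      ← (hT.eigenvectorBasis rfl).repr.inner_map_map]
    simp only [PiLp.inner_apply, hT.eigenvectorBasis_apply_self_apply rfl]
    refine Finset.sum_congr rfl fun i _ => ?_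
    simp; ring
  have h2 : ‖x‖ ^ 2 = ∑ i, (hT.eigenvectorBasis rfl).repr x i ^ 2 := by
    rw [← (hT.eigenvectorBasis rfl).repr.norm_map x, EuclideanSpace.real_norm_sq_eq]
  rw [h1, mul_pow, h2, Finset.mul_sum]
  refine Finset.sum_le_sum fun i _ => mul_le_mul_of_nonneg_right ?_ (sq_nonneg _)
  rw [← T.sq_singularValues_fin rfl i]
  exact pow_le_pow_left₀ (T.singularValues_nonneg _) (T.singularValues_antitone (Nat.zero_le _)) 2

theorem norm_row_le_twoInftyNorm {ι κ : Type*} [Fintype ι] [Fintype κ] (Z : Matrix ι κ ℝ) (i : ι) :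
    ‖WithLp.toLp 2 (Z i)‖ ≤ twoInftyNorm Z :=
  le_ciSup (f := fun i => ‖WithLp.toLp 2 (Z i)‖) (Set.finite_range _).bddAbove i

/-- Squared row norms are the diagonal of `Z * Zᵀ`, which `R` leaves unchanged. -/
theorem twoInftyNorm_mul_orthogonal {ι κ : Type*} [Fintype ι] [Fintype κ] [DecidableEq κ]
    (Z : Matrix ι κ ℝ) {R : Matrix κ κ ℝ} (hR : R * Rᵀ = 1) :
    twoInftyNorm (Z * R) = twoInftyNorm Z := by
  unfold twoInftyNorm
  congr! 2 with i
  rw [← sq_eq_sq₀ (norm_nonneg _) (norm_nonneg _), EuclideanSpace.real_norm_sq_eq,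
    EuclideanSpace.real_norm_sq_eq]
  have h : ((Z * R) * (Z * R)ᵀ) i i = (Z * Zᵀ) i i := by
    rw [Matrix.transpose_mul, Matrix.mul_assoc, ← Matrix.mul_assoc R, hR, Matrix.one_mul]
  simpa [Matrix.mul_apply, sq, -Matrix.transpose_mul] using h

theorem sum_col_sq_of_orthonormal {ι κ : Type*} [Fintype ι] [DecidableEq κ]
    {U : Matrix ι κ ℝ} (hU : Uᵀ * U = 1) (k : κ) : ∑ i, U i k ^ 2 = 1 := by
  have h := congr_fun (congr_fun hU k) k
  simpa [Matrix.mul_apply, sq] using h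

theorem sum_row_sq_le {ι κ : Type*} [Fintype ι] [Fintype κ] {U : Matrix ι κ ℝ} {b : ℝ}
    (hb : 0 ≤ b) (hU : twoInftyNorm U ≤ √b) (i : ι) : ∑ k, U i k ^ 2 ≤ b := by
  have h := (norm_row_le_twoInftyNorm U i).trans hU
  have h2 := EuclideanSpace.real_norm_sq_eq (WithLp.toLp 2 (U i))
  have h3 := pow_le_pow_left₀ (norm_nonneg _) h 2
  rw [Real.sq_sqrt hb, h2] at h3
  exact h3

/-! ### Compact singular value decompositions -/

variable {n₁ n₂ r : ℕ} {X : Matrix (Fin n₁) (Fin n₂) ℝ} {U : Matrix (Fin n₁) (Fin r) ℝ}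
  {σ : Fin r → ℝ} {V : Matrix (Fin n₂) (Fin r) ℝ}

/-- A compact singular value decomposition reconstructs the matrix. -/
theorem IsRankSVD.eq_mul_of_rank_eq (h : IsRankSVD X U σ V) (hX : X.rank = r) :
    X = U * Matrix.diagonal σ * Vᵀ := by
  have hσ : ∀ i, 0 < σ i := fun i => by
    rw [h.eq_singularValue, singularValue_pos_iff, hX]; exact i.2
  have hU : U.rank = r := by
    have := Matrix.rank_transpose_mul_self U
    rw [h.orthonormal_left, Matrix.rank_one, Fintype.card_fin] at this
    exact this.symm
  -- Both ranges have dimension `r`, so they agree; as `X * V = U * diagonal σ`, the range of `X`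
  -- lies in that of `U`, which `U * Uᵀ` fixes.
  have hle : LinearMap.range (X * V).mulVecLin ≤ LinearMap.range X.mulVecLin := by
    rw [Matrix.mulVecLin_mul]; exact LinearMap.range_comp_le_range _ _
  have hrank : (X * V).rank = r := by
    rw [h.mul_right, Matrix.rank_mul_eq_left_of_isUnit_det _ _ _, hU]
    rw [Matrix.det_diagonal]
    exact (Finset.prod_ne_zero_iff.2 fun i _ => (hσ i).ne').isUnit
  have heq := Submodule.eq_of_le_of_finrank_eq hle
    (show (X * V).rank = X.rank by rw [hrank, hX])
  have hproj : U * (Uᵀ * X) = X := by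
    rw [← Matrix.toLin'.injective.eq_iff]
    refine LinearMap.ext fun x => ?_
    have hx : X *ᵥ x ∈ LinearMap.range (X * V).mulVecLin := by
      rw [heq]; exact ⟨x, rfl⟩
    obtain ⟨y, hy⟩ := hx
    rw [h.mul_right, Matrix.mulVecLin_apply] at hy
    rw [Matrix.toLin'_apply, Matrix.toLin'_apply, ← Matrix.mul_assoc, ← Matrix.mulVec_mulVec, ← hy,
      Matrix.mulVec_mulVec, Matrix.mul_assoc U Uᵀ, ← Matrix.mul_assoc Uᵀ, h.orthonormal_left,
      Matrix.one_mul]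
  have ht : Uᵀ * X = Matrix.diagonal σ * Vᵀ := by
    rw [← Matrix.transpose_inj]
    simp [Matrix.transpose_mul, h.transpose_mul_left]
  rw [Matrix.mul_assoc, ← ht, hproj]

theorem IsRankSVD.nonneg (h : IsRankSVD X U σ V) (i : Fin r) : 0 ≤ σ i := by
  rw [h.eq_singularValue]; exact singularValue_nonneg _ _

theorem IsRankSVD.le_first (h : IsRankSVD X U σ V) (hr : 0 < r) (i : Fin r) : σ i ≤ σ ⟨0, hr⟩ := by
  rw [h.eq_singularValue, h.eq_singularValue]
  exact LinearMap.singularValues_antitone _ (Nat.zero_le _)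

/-- Cauchy–Schwarz on the entry expansion, with every `σ k` bounded by the first. -/
theorem IsRankSVD.sq_entry_le (h : IsRankSVD X U σ V) (hX : X.rank = r) (hr : 0 < r)
    (i : Fin n₁) (j : Fin n₂) :
    X i j ^ 2 ≤ σ ⟨0, hr⟩ ^ 2 * ((∑ k, U i k ^ 2) * ∑ k, V j k ^ 2) := by
  have hx : X i j = ∑ k, (σ k * U i k) * V j k := by
    conv_lhs => rw [h.eq_mul_of_rank_eq hX]
    rw [Matrix.mul_apply]
    simp only [Matrix.mul_diagonal, Matrix.transpose_apply]
    exact Finset.sum_congr rfl fun k _ => by ring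
  rw [hx, ← mul_assoc]
  refine (Finset.sum_mul_sq_le_sq_mul_sq _ _ _).trans ?_
  refine mul_le_mul_of_nonneg_right ?_ (Finset.sum_nonneg fun _ _ => sq_nonneg _)
  rw [Finset.mul_sum]
  refine Finset.sum_le_sum fun k _ => ?_
  rw [mul_pow]
  exact mul_le_mul_of_nonneg_right (pow_le_pow_left₀ (h.nonneg k) (h.le_first hr k) 2) (sq_nonneg _)

theorem IsRankSVD.bilinear_first (h : IsRankSVD X U σ V) (k : Fin r) :
    ∑ ij : Fin n₁ × Fin n₂, U ij.1 k * X ij.1 ij.2 * V ij.2 k = σ k := by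
  have h1 : (Uᵀ * (X * V)) k k = σ k := by
    rw [h.mul_right, ← Matrix.mul_assoc, h.orthonormal_left, Matrix.one_mul, Matrix.diagonal_apply_eq]
  rw [← h1, Fintype.sum_prod_type]
  simp [Matrix.mul_apply, Finset.mul_sum, mul_assoc]

/-- Testing against unit vectors bounds the largest singular value from below. -/
theorem bilinear_le_singularValue_zero (A : Matrix (Fin n₁) (Fin n₂) ℝ) {u : Fin n₁ → ℝ}
    {v : Fin n₂ → ℝ} (hu : ∑ i, u i ^ 2 = 1) (hv : ∑ j, v j ^ 2 = 1) :
    ∑ ij : Fin n₁ × Fin n₂, u ij.1 * A ij.1 ij.2 * v ij.2 ≤ singularValue A 0 := by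
  have hu' : ‖WithLp.toLp 2 u‖ = 1 := by
    rw [EuclideanSpace.norm_eq]; simp [hu]
  have hv' : ‖WithLp.toLp 2 v‖ = 1 := by
    rw [EuclideanSpace.norm_eq]; simp [hv]
  have h1 := real_inner_le_norm (A.toEuclideanLin (WithLp.toLp 2 v)) (WithLp.toLp 2 u)
  have h2 := norm_le_singularValues_zero A.toEuclideanLin (WithLp.toLp 2 v)
  rw [hu', mul_one] at h1
  rw [hv', mul_one] at h2
  refine le_trans (le_of_eq ?_) (h1.trans h2)
  simp [PiLp.inner_apply, Matrix.toLpLin_apply, Matrix.mulVec, dotProduct, Fintype.sum_prod_type,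
    Finset.mul_sum, mul_assoc]

theorem one_le_condNumber (hX : 0 < X.rank) :
    1 ≤ condNumber X := by
  unfold condNumber
  rw [one_le_div (singularValue_pos_iff.2 (by omega))]
  exact LinearMap.singularValues_antitone _ (Nat.zero_le _)

/-- The squared entries of `U` total `r` by columns and at most `μ * r` by rows. -/
theorem IsIncoherent.one_le {μ : ℝ} (hi : IsIncoherent μ U V) (h : Uᵀ * U = 1) (hr : 0 < r) :
    1 ≤ μ := by
  have hrow := norm_row_le_twoInftyNorm U
  have hcol : ∑ i, ∑ k, U i k ^ 2 = r := by
    rw [Finset.sum_comm]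
    simp [sum_col_sq_of_orthonormal h]
  have hr' : (0 : ℝ) < r := by exact_mod_cast hr
  have hn : (0 : ℝ) < n₁ := by
    rcases Nat.eq_zero_or_pos n₁ with h0 | h0
    · subst h0; simp at hcol; exact absurd hcol.symm hr'.ne'
    · exact_mod_cast h0
  -- For a negative argument `√` is `0`, which would force `U = 0`.
  have hμ : 0 ≤ μ * r / n₁ := by
    by_contra hneg
    push Not at hneg
    have h0 : ∀ i, ∑ k, U i k ^ 2 ≤ 0 := fun i => by
      refine sum_row_sq_le le_rfl ?_ i
      have := hi.1
      rwa [Real.sqrt_eq_zero_of_nonpos hneg.le, ← Real.sqrt_zero] at this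
    have := Finset.sum_nonpos fun i (_ : i ∈ Finset.univ) => h0 i
    linarith
  have := Finset.sum_le_sum fun i (_ : i ∈ Finset.univ) => sum_row_sq_le hμ hi.1 i
  rw [hcol] at this
  simp only [Finset.sum_const, Finset.card_univ, Fintype.card_fin, nsmul_eq_mul] at this
  rw [mul_div_cancel₀ _ hn.ne'] at this
  nlinarith

/-! ### Norms of lifted factors -/

/-- The operator norm of a lifted factor dominates the norm of its first column. -/
theorem sqrt_two_mul_le_opNorm_liftedFactor (hU : Uᵀ * U = 1) (hV : Vᵀ * V = 1) (k : Fin r)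
    (hσ : 0 ≤ σ k) : √(2 * σ k) ≤ opNorm (liftedFactor U σ V) := by
  have h := Matrix.l2_opNorm_mulVec (liftedFactor U σ V) (EuclideanSpace.single k 1)
  rw [PiLp.norm_single, norm_one, mul_one] at h
  refine le_trans (le_of_eq ?_) h
  rw [EuclideanSpace.norm_eq]
  congr 1
  simp only [liftedFactor, Matrix.fromRows_mul, Real.norm_eq_abs, sq_abs, Fintype.sum_sum_type]
  simp [Matrix.mul_diagonal, mul_pow, Real.sq_sqrt hσ, ← Finset.sum_mul,
    sum_col_sq_of_orthonormal hU, sum_col_sq_of_orthonormal hV, two_mul]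

theorem twoInftyNorm_liftedFactor_le {b s : ℝ} (hσ₀ : ∀ k, 0 ≤ σ k) (hσ : ∀ k, σ k ≤ s)
    (hs : 0 ≤ s) (hU : ∀ i, ∑ k, U i k ^ 2 ≤ b) (hV : ∀ i, ∑ k, V i k ^ 2 ≤ b) :
    twoInftyNorm (liftedFactor U σ V) ≤ √(b * s) := by
  have key : ∀ w : Fin r → ℝ, ∑ k, w k ^ 2 ≤ b → ∑ k, (w k * √(σ k)) ^ 2 ≤ b * s := fun w hw => by
    refine le_trans ?_ (mul_le_mul_of_nonneg_right hw hs)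
    rw [Finset.sum_mul]
    refine Finset.sum_le_sum fun k _ => ?_
    rw [mul_pow, Real.sq_sqrt (hσ₀ k)]
    exact mul_le_mul_of_nonneg_left (hσ k) (sq_nonneg _)
  refine Real.iSup_le (fun i => ?_) (Real.sqrt_nonneg _)
  rw [EuclideanSpace.norm_eq]
  refine Real.sqrt_le_sqrt ?_
  simp only [liftedFactor, Real.norm_eq_abs, sq_abs, Matrix.mul_diagonal]
  rcases i with i | i
  · exact key _ (hU i)
  · exact key _ (hV i)

/-! ### Tail bound and feasibility -/

/-- The second moment of the summands of `u₁ᵀ X v₁`. -/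
theorem IsRankSVD.sum_sq_le (h : IsRankSVD X U σ V) (hX : X.rank = r) (hr : 0 < r) {b : ℝ}
    (hU : ∀ i, ∑ k, U i k ^ 2 ≤ b) (hV : ∀ i, ∑ k, V i k ^ 2 ≤ b) (hb : 0 ≤ b) :
    ∑ ij : Fin n₁ × Fin n₂, (U ij.1 ⟨0, hr⟩ * X ij.1 ij.2 * V ij.2 ⟨0, hr⟩) ^ 2 ≤
      (σ ⟨0, hr⟩ * b) ^ 2 := by
  calc _ ≤ ∑ ij : Fin n₁ × Fin n₂,
        (σ ⟨0, hr⟩ * b) ^ 2 * (U ij.1 ⟨0, hr⟩ ^ 2 * V ij.2 ⟨0, hr⟩ ^ 2) := by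
        refine Finset.sum_le_sum fun ij _ => ?_
        have h1 : X ij.1 ij.2 ^ 2 ≤ (σ ⟨0, hr⟩ * b) ^ 2 := by
          refine (h.sq_entry_le hX hr ij.1 ij.2).trans ?_
          rw [mul_pow, sq b]
          exact mul_le_mul_of_nonneg_left (mul_le_mul (hU _) (hV _)
            (Finset.sum_nonneg fun _ _ => sq_nonneg _) hb) (sq_nonneg _)
        rw [mul_pow, mul_pow, mul_comm (U _ _ ^ 2), mul_assoc]
        exact mul_le_mul_of_nonneg_right h1 (by positivity)
    _ = (σ ⟨0, hr⟩ * b) ^ 2 := by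
        rw [← Finset.mul_sum, Fintype.sum_prod_type]
        simp [← Finset.mul_sum, sum_col_sq_of_orthonormal h.orthonormal_left,
          sum_col_sq_of_orthonormal h.orthonormal_right]

/-- With high probability the rescaled sample keeps half of the largest singular value. -/
theorem IsRankSVD.sample_singularValue_tail (h : IsRankSVD X U σ V) (hX : X.rank = r) (hr : 0 < r)
    {b L : ℝ} (hU : ∀ i, ∑ k, U i k ^ 2 ≤ b) (hV : ∀ i, ∑ k, V i k ^ 2 ≤ b) (hb : 0 < b)
    (p : unitInterval) (hp₀ : 0 < (p : ℝ)) (hL : 0 ≤ L) (hp : 2 * b * L ≤ p) :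
    (ProbabilityTheory.setBernoulli (Set.univ : Set (Fin n₁ × Fin n₂)) p).real
      {Ω | singularValue ((p : ℝ)⁻¹ • sample Ω X) 0 < σ ⟨0, hr⟩ / 2} ≤ Real.exp (-(2 * L ^ 2)) := by
  classical
  set s := σ ⟨0, hr⟩ with hs
  have hs₀ : 0 < s := by
    rw [hs, h.eq_singularValue, singularValue_pos_iff, hX]; exact hr
  set a : Fin n₁ × Fin n₂ → ℝ := fun ij => U ij.1 ⟨0, hr⟩ * X ij.1 ij.2 * V ij.2 ⟨0, hr⟩ with ha
  have hsum : ∑ ij, a ij = s := h.bilinear_first _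
  have hsq : ∑ ij, a ij ^ 2 ≤ (s * b) ^ 2 := h.sum_sq_le hX hr hU hV hb.le
  -- The Hoeffding exponent divides by this sum; division by zero would return `0` and make the
  -- bound vacuous.
  have hpos : 0 < ∑ ij, a ij ^ 2 := by
    refine lt_of_le_of_ne (Finset.sum_nonneg fun _ _ => sq_nonneg _) fun h0 => hs₀.ne ?_
    rw [eq_comm, Finset.sum_eq_zero_iff_of_nonneg fun _ _ => sq_nonneg _] at h0
    rw [← hsum, eq_comm]
    exact Finset.sum_eq_zero fun i hi => by simpa using h0 i hi
  have htail := setBernoulli_weighted_sum_lower_tail p a (ε := p * s / 2) (by positivity)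
  refine (MeasureTheory.measureReal_mono ?_).trans (htail.trans (Real.exp_le_exp.2 ?_))
  · intro Ω hΩ
    simp only [Set.mem_ofPred_eq] at hΩ ⊢
    have hle := (bilinear_le_singularValue_zero ((p : ℝ)⁻¹ • sample Ω X)
      (sum_col_sq_of_orthonormal h.orthonormal_left ⟨0, hr⟩)
      (sum_col_sq_of_orthonormal h.orthonormal_right ⟨0, hr⟩)).trans_lt hΩ
    have heq : ∑ ij : Fin n₁ × Fin n₂, U ij.1 ⟨0, hr⟩ * ((p : ℝ)⁻¹ • sample Ω X) ij.1 ij.2 *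
        V ij.2 ⟨0, hr⟩ = (p : ℝ)⁻¹ * ∑ ij, if ij ∈ Ω then a ij else 0 := by
      rw [Finset.mul_sum]
      refine Finset.sum_congr rfl fun ij _ => ?_
      simp only [Matrix.smul_apply, sample, Matrix.of_apply, smul_eq_mul, ha]
      split_ifs <;> ring
    rw [heq, inv_mul_lt_iff₀ hp₀] at hle
    rw [hsum]
    linarith
  · have hhalf : 2 * ∑ i, (|a i| / 2) ^ 2 = (∑ i, a i ^ 2) / 2 := by
      rw [Finset.mul_sum, Finset.sum_div]
      refine Finset.sum_congr rfl fun i _ => ?_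
      rw [div_pow, sq_abs]; ring
    rw [hhalf, neg_div, neg_le_neg_iff, le_div_iff₀ (by positivity)]
    have h1 : (2 * b * L) ^ 2 ≤ (p : ℝ) ^ 2 := pow_le_pow_left₀ (by positivity) hp 2
    calc 2 * L ^ 2 * ((∑ i, a i ^ 2) / 2) ≤ 2 * L ^ 2 * ((s * b) ^ 2 / 2) := by gcongr
      _ = s ^ 2 / 4 * (2 * b * L) ^ 2 := by ring
      _ ≤ s ^ 2 / 4 * (p : ℝ) ^ 2 := by gcongr
      _ = (p * s / 2) ^ 2 := by ring

/-- A lower bound on the largest singular value of the initial matrix gives feasibility. -/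
theorem IsRankSVD.solutionSet_subset_feasibleSet (h : IsRankSVD X U σ V) (hr : 0 < r) {μ : ℝ}
    (hμ : 0 ≤ μ) (hU : ∀ i, ∑ k, U i k ^ 2 ≤ μ * r / (min n₁ n₂ : ℕ))
    (hV : ∀ i, ∑ k, V i k ^ 2 ≤ μ * r / (min n₁ n₂ : ℕ)) {A : Matrix (Fin n₁) (Fin n₂) ℝ}
    (hA : σ ⟨0, hr⟩ / 2 ≤ singularValue A 0) {U₀ : Matrix (Fin n₁) (Fin r) ℝ} {σ₀ : Fin r → ℝ}
    {V₀ : Matrix (Fin n₂) (Fin r) ℝ} (h₀ : IsRankSVD A U₀ σ₀ V₀) :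
    twoInftyNorm (liftedFactor U σ V) ≤
        √(2 * μ * r / (min n₁ n₂ : ℕ)) * opNorm (liftedFactor U₀ σ₀ V₀) ∧
      solutionSet (liftedFactor U σ V) ⊆ feasibleSet μ (liftedFactor U₀ σ₀ V₀) := by
  have hmain : twoInftyNorm (liftedFactor U σ V) ≤
      √(2 * μ * r / (min n₁ n₂ : ℕ)) * opNorm (liftedFactor U₀ σ₀ V₀) := by
    have hs := h.nonneg ⟨0, hr⟩
    -- Every truncated decomposition of `A` has this same first value, so one event serves all
    -- choices.
    have h1 : singularValue A 0 = σ₀ ⟨0, hr⟩ := (h₀.eq_singularValue ⟨0, hr⟩).symm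
    have h2 := sqrt_two_mul_le_opNorm_liftedFactor h₀.orthonormal_left h₀.orthonormal_right
      ⟨0, hr⟩ (h₀.nonneg _)
    calc twoInftyNorm (liftedFactor U σ V)
        ≤ √(μ * r / (min n₁ n₂ : ℕ) * σ ⟨0, hr⟩) :=
          twoInftyNorm_liftedFactor_le h.nonneg (h.le_first hr) hs hU hV
      _ ≤ √(2 * μ * r / (min n₁ n₂ : ℕ) * (2 * σ₀ ⟨0, hr⟩)) := by
          refine Real.sqrt_le_sqrt (mul_le_mul ?_ (by linarith) hs (by positivity))
          gcongr
          linarith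
      _ = √(2 * μ * r / (min n₁ n₂ : ℕ)) * √(2 * σ₀ ⟨0, hr⟩) := Real.sqrt_mul (by positivity) _
      _ ≤ _ := mul_le_mul_of_nonneg_left h2 (Real.sqrt_nonneg _)
  refine ⟨hmain, ?_⟩
  rintro _ ⟨R, hR, -, rfl⟩
  change twoInftyNorm _ ≤ _
  rwa [twoInftyNorm_mul_orthogonal _ hR]

end MatrixCompletion

theorem mainTheorem5 :
    ∃ c c₁ c₂ : ℝ, 0 < c ∧ 0 < c₁ ∧ 0 < c₂ ∧
      ∀ (n₁ n₂ r : ℕ) (_hr : 0 < r)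
        (X : Matrix (Fin n₁) (Fin n₂) ℝ) (_hX : X.rank = r)
        (U : Matrix (Fin n₁) (Fin r) ℝ) (σ : Fin r → ℝ) (V : Matrix (Fin n₂) (Fin r) ℝ)
        (_hsvd : MatrixCompletion.IsRankSVD X U σ V)
        (μ : ℝ) (_hμ : MatrixCompletion.IsIncoherent μ U V)
        (p : unitInterval) (_hp₀ : 0 < (p : ℝ))
        (_hp : c * μ * (r : ℝ) ^ 2 * MatrixCompletion.condNumber X ^ 2 *
            Real.log (max n₁ n₂ : ℕ) / (min n₁ n₂ : ℕ) ≤ (p : ℝ)),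
        1 - c₁ * ((max n₁ n₂ : ℕ) : ℝ) ^ (-c₂) ≤
          (ProbabilityTheory.setBernoulli (Set.univ : Set (Fin n₁ × Fin n₂)) p).real
            {Ω | ∀ (U₀ : Matrix (Fin n₁) (Fin r) ℝ) (σ₀ : Fin r → ℝ)
                (V₀ : Matrix (Fin n₂) (Fin r) ℝ),
                MatrixCompletion.IsRankSVD
                  ((p : ℝ)⁻¹ • MatrixCompletion.sample Ω X) U₀ σ₀ V₀ →
                MatrixCompletion.twoInftyNorm (MatrixCompletion.liftedFactor U σ V) ≤
                    √(2 * μ * r / (min n₁ n₂ : ℕ)) *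
                      MatrixCompletion.opNorm (MatrixCompletion.liftedFactor U₀ σ₀ V₀) ∧
                  MatrixCompletion.solutionSet (MatrixCompletion.liftedFactor U σ V) ⊆
                    MatrixCompletion.feasibleSet μ
                      (MatrixCompletion.liftedFactor U₀ σ₀ V₀)} := by
  refine ⟨2, 1, 1, by norm_num, one_pos, one_pos, ?_⟩
  intro n₁ n₂ r hr X hX U σ V hsvd μ hμ p hp₀ hp
  have hμ₁ : 1 ≤ μ := hμ.one_le hsvd.orthonormal_left hr
  have hκ : 1 ≤ MatrixCompletion.condNumber X ^ 2 :=
    one_le_pow₀ (MatrixCompletion.one_le_condNumber (hX ▸ hr))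
  have hr₁ : (1 : ℝ) ≤ r := by exact_mod_cast hr
  have hn₁ : 0 < n₁ := by
    have := X.rank_le_height; omega
  have hn₂ : 0 < n₂ := by
    have := X.rank_le_width; omega
  have hm : (0 : ℝ) < (min n₁ n₂ : ℕ) := by exact_mod_cast lt_min hn₁ hn₂
  have hrow : ∀ {n : ℕ} {W : Matrix (Fin n) (Fin r) ℝ}, min n₁ n₂ ≤ n →
      MatrixCompletion.twoInftyNorm W ≤ √(μ * r / n) →
      ∀ i, ∑ k, W i k ^ 2 ≤ μ * r / (min n₁ n₂ : ℕ) := by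
    intro n W hn hW i
    refine (MatrixCompletion.sum_row_sq_le (by positivity) hW i).trans ?_
    gcongr
  have hU := hrow (min_le_left _ _) hμ.1
  have hV := hrow (min_le_right _ _) hμ.2
  set N := max n₁ n₂ with hN
  -- For `N = 1` the claimed lower bound is `1 - 1 = 0`; otherwise `2 * log N ≥ 1`, so `exp (-2 log²
  -- N) ≤ N⁻¹`.
  rcases Nat.lt_or_ge N 2 with h2 | h2
  · have hN₁ : N = 1 := by omega
    rw [hN₁]
    simp
  set L := Real.log (N : ℝ) with hL
  have hL₂ : 1 ≤ 2 * L := by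
    have := Real.log_le_log two_pos (show (2 : ℝ) ≤ N by exact_mod_cast h2)
    have := Real.log_two_gt_d9
    linarith
  have hpL : 2 * (μ * r / (min n₁ n₂ : ℕ)) * L ≤ p := by
    refine le_trans ?_ hp
    rw [mul_div_assoc', div_mul_eq_mul_div]
    refine div_le_div_of_nonneg_right ?_ hm.le
    -- The extra factor `r κ²` in the sampling rate enters only through being at least `1`.
    have : (r : ℝ) ≤ r ^ 2 * MatrixCompletion.condNumber X ^ 2 := by nlinarith
    nlinarith [mul_le_mul_of_nonneg_left this (show 0 ≤ 2 * μ * L by nlinarith)]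
  have htail := hsvd.sample_singularValue_tail hX hr hU hV (by positivity) p hp₀ (by linarith) hpL
  have hexp : Real.exp (-(2 * L ^ 2)) ≤ 1 * (N : ℝ) ^ (-1 : ℝ) := by
    rw [one_mul, Real.rpow_def_of_pos (by positivity), Real.exp_le_exp]
    nlinarith
  set P := ProbabilityTheory.setBernoulli (Set.univ : Set (Fin n₁ × Fin n₂)) p
  set B := {Ω : Set (Fin n₁ × Fin n₂) |
    MatrixCompletion.singularValue ((p : ℝ)⁻¹ • MatrixCompletion.sample Ω X) 0 < σ ⟨0, hr⟩ / 2}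
  -- Subadditivity suffices here, with no measurability of `B` to check.
  have hB : 1 ≤ P.real B + P.real Bᶜ := by
    have := MeasureTheory.measureReal_union_le (μ := P) B Bᶜ
    rwa [Set.union_compl_self, MeasureTheory.probReal_univ] at this
  refine (show _ ≤ P.real Bᶜ by linarith).trans (MeasureTheory.measureReal_mono ?_)
  intro Ω hΩ U₀ σ₀ V₀ h₀
  exact hsvd.solutionSet_subset_feasibleSet hr (by linarith) hU hV (not_lt.1 hΩ) h₀
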